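/- **Model.** There are $C$ identical servers. An instance $\tau$ is a finite set $\mathcal J$ of labelled jobs; job $j$ has a value $v_j>0$, a demand $D_j>0$, an arrival time $a_j\ge 0$ and a deadline $d_j$. A schedule says which job (if any) each server processes at each time (measurably); job $j$ may be processed only during $[a_j,d_j]$ and on at most one server at a time, preemption is allowed, and $j$ is completed if it is processed for $D_j$ time units in total. The value of a schedule is the total value of the completed jobs, and $v(OPT(\tau))$ is the optimal offline value (migration allowed). An online algorithm $\mathcal A$ produces a schedule whose action at time $t$ depends only on the jobs that have arrived by time $t$; $v(\mathcal A(\tau))$ is its value. It is non-migratory if no job is ever processed on two different servers. The slackness of a non-empty instance is $s(\tau)=\min_j (d_j-a_j)/D_j$, and $\mathrm{cr}_{\mathcal A}(s)=\sup_{\tau:\,s(\tau)=s} v(OPT(\tau))/v(\mathcal A(\tau))\in[0,\infty]$. Let $v(OPT^*(\tau))$ be the infimum of the dual cost $\sum_j D_j\alpha_j+\sum_{i=1}^C\int_0^\infty\beta_i(t)\,dt$ over $\alpha_j\ge 0$ and measurable $\beta_i\ge 0$ with $\alpha_j+\beta_i(t)\ge v_j/D_j$ for all $j$, $i$ and $t\in[a_j,d_j]$.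 Put $\mathrm{cr}^*_{\mathcal A}(s)=\sup_{\tau:\,s(\tau)=s} v(OPT^*(\tau))/v(\mathcal A(\tau))$. Say that $\mathcal A$ *induces an upper bound on the integrality gap at slackness $s$* if $\mathrm{cr}^*_{\mathcal A}(s)\le \mathrm{cr}_{\mathcal A}(s)$, i.e. (when $\mathrm{cr}_{\mathcal A}(s)<\infty$) if $v(OPT^*(\tau))\le \mathrm{cr}_{\mathcal A}(s)\, v(\mathcal A(\tau))$ for every instance $\tau$ of slackness $s$. A scheduler that announces decisions is $\beta$-responsive on inputs of slackness at least $s$ (all $d_j-a_j\ge sD_j$) if, for every such input and every job $j$, it accepts or rejects $j$ by time $d_j-\beta D_j$, where decisions are made online, are final and mutually exclusive, every accepted job is completed by its deadline, and rejected jobs are not completed. **Reduction.** Let $0<\omega<1$ and let $\mathcal A$ be a non-migratory online algorithm for $C$ servers. The committed algorithm $\mathcal A_C$ simulates $\mathcal A$ on $C$ virtual servers, giving it each job $j$ with the virtual type $\langle v_j,\;D_j/\omega,\;a_j,\;\hat d_j\rangle$, $\hat d_j=d_j-\omega(d_j-a_j)$. When $\mathcal A$ completes $j$ on virtual server $i$,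 job $j$ (with its true demand and deadline) is accepted and admitted to server $i$; if this has not happened by time $\hat d_j$, then $j$ is rejected at time $\hat d_j$. Each server runs the earliest-deadline-first rule on the jobs admitted to it that are not yet completed (ties broken in any measurable online way). **Statement.** Let $s>\frac1{\omega(1-\omega)}$. Such an algorithm $\mathcal A_C$ exists, and every such $\mathcal A_C$ is a non-migratory online algorithm (all its schedules are feasible), is $\omega s$-responsive on inputs of slackness at least $s$, and satisfies $$\mathrm{cr}_{\mathcal A_C}(s)\le\frac{\mathrm{cr}^*_{\mathcal A}\big(s\,\omega(1-\omega)\big)}{\omega(1-\omega)} .$$ In particular, if $\mathcal A$ induces an upper bound on the integrality gap at slackness $s\,\omega(1-\omega)$, then $$\mathrm{cr}_{\mathcal A_C}(s)\le\frac{\mathrm{cr}_{\mathcal A}\big(s\,\omega(1-\omega)\big)}{\omega(1-\omega)} .$$ -/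

import Mathlib

open MeasureTheory Set
open scoped ENNReal NNReal

noncomputable section

namespace Sched

/-- The type `⟨v, D, a, d⟩` of a job: value, demand, arrival time, deadline. -/
structure JobType where
  value : ℝ
  demand : ℝ
  arrival : ℝ
  deadline : ℝ
  value_pos : 0 < value
  demand_pos : 0 < demand
  arrival_nonneg : 0 ≤ arrival

/-- A finite set of job requests, identified by labels, with a type for each of them.
(The values of `type` at labels outside `jobs` have no meaning and are never used.) -/
structure Instance where
  jobs : Finset ℕ
  type : ℕ → JobType

/-- `s(τ) = s`: the minimum of `(d_j - a_j) / D_j` over the jobs of `τ` exists and equals `s`. -/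
def HasSlackness (τ : Instance) (s : ℝ) : Prop :=
  IsLeast {x : ℝ | ∃ j ∈ τ.jobs,
    x = ((τ.type j).deadline - (τ.type j).arrival) / (τ.type j).demand} s

/-- Every job satisfies `d_j - a_j ≥ s D_j`. -/
def SlacknessAtLeast (τ : Instance) (s : ℝ) : Prop :=
  ∀ j ∈ τ.jobs, s * (τ.type j).demand ≤ (τ.type j).deadline - (τ.type j).arrival

/-- A schedule on `C` servers: the job (if any) that each server processes at each time. -/
abbrev Schedule (C : ℕ) := Fin C → ℝ → Option ℕ

/-- The processing times are measurable. -/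
def MeasurableSchedule {C : ℕ} (σ : Schedule C) : Prop :=
  ∀ i j, MeasurableSet {t : ℝ | σ i t = some j}

/-- A legal schedule for `τ`: only jobs of `τ` are processed, inside their availability windows,
and no job is processed by two servers at the same time. -/
structure Feasible {C : ℕ} (τ : Instance) (σ : Schedule C) : Prop where
  measurable : MeasurableSchedule σ
  window : ∀ i t j, σ i t = some j →
    j ∈ τ.jobs ∧ t ∈ Icc (τ.type j).arrival (τ.type j).deadline
  one_server : ∀ i i' t j, σ i t = some j → σ i' t = some j → i = i'

/-- No job is ever processed by two different servers. -/
def NonMigratorySchedule {C : ℕ} (σ : Schedule C) : Prop :=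
  ∀ i i' t t' j, σ i t = some j → σ i' t' = some j → i = i'

/-- Total time for which server `i` processes job `j` up to time `t`. -/
def work {C : ℕ} (σ : Schedule C) (i : Fin C) (j : ℕ) (t : ℝ) : ℝ≥0∞ :=
  volume {u : ℝ | u ≤ t ∧ σ i u = some j}

/-- Job `j` is completed: it receives `D_j` units of processing during `[a_j, d_j]`. -/
def Completed {C : ℕ} (τ : Instance) (σ : Schedule C) (j : ℕ) : Prop :=
  ENNReal.ofReal (τ.type j).demand ≤
    ∑ i, volume {u : ℝ | u ∈ Icc (τ.type j).arrival (τ.type j).deadline ∧ σ i u = some j}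

/-- Server `i` alone has completed job `j` (within its availability window) by time `t`. -/
def CompletedOnBy {C : ℕ} (τ : Instance) (σ : Schedule C) (i : Fin C) (j : ℕ) (t : ℝ) : Prop :=
  ENNReal.ofReal (τ.type j).demand ≤
    volume {u : ℝ | u ∈ Icc (τ.type j).arrival (τ.type j).deadline ∧ u ≤ t ∧ σ i u = some j}

open Classical in
/-- The total value of the completed jobs. -/
def value {C : ℕ} (τ : Instance) (σ : Schedule C) : ℝ≥0∞ :=
  ∑ j ∈ τ.jobs with Completed τ σ j, ENNReal.ofReal (τ.type j).value

/-- `v(OPT(τ))`: the optimal offline value on `C` servers, migration being allowed. -/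
def opt (C : ℕ) (τ : Instance) : ℝ≥0∞ :=
  ⨆ (σ : Schedule C) (_ : Feasible τ σ), value τ σ

/-- A (deterministic) scheduling algorithm. -/
abbrev Scheduler (C : ℕ) := Instance → Schedule C

/-- The same jobs, with the same types, have arrived by time `t` in `τ` and in `τ'`. -/
def AgreeUpTo (t : ℝ) (τ τ' : Instance) : Prop :=
  (∀ j, (j ∈ τ.jobs ∧ (τ.type j).arrival ≤ t) ↔ (j ∈ τ'.jobs ∧ (τ'.type j).arrival ≤ t)) ∧
    ∀ j ∈ τ.jobs, (τ.type j).arrival ≤ t → τ.type j = τ'.type j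

/-- What is done at time `t` depends only on the jobs that have arrived by time `t`. -/
def Causal {C : ℕ} (A : Scheduler C) : Prop :=
  ∀ τ τ' t, AgreeUpTo t τ τ' → ∀ i, A τ i t = A τ' i t

/-- An online scheduling algorithm. -/
structure IsOnline {C : ℕ} (A : Scheduler C) : Prop where
  feasible : ∀ τ, Feasible τ (A τ)
  causal : Causal A

def NonMigratory {C : ℕ} (A : Scheduler C) : Prop :=
  ∀ τ, NonMigratorySchedule (A τ)

/-- `cr_A(s)`: the worst ratio `v(OPT(τ)) / v(A(τ))` over the instances of slackness `s`. -/
def competitiveRatio {C : ℕ} (A : Scheduler C) (s : ℝ) : ℝ≥0∞ :=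
  ⨆ (τ : Instance) (_ : HasSlackness τ s), opt C τ / value τ (A τ)

/-- Feasibility for the dual program in the variables `α_j` and `β_i(t)`:
`α_j + β_i(t) ≥ v_j / D_j` for all jobs `j`, servers `i` and times `t ∈ [a_j, d_j]`. -/
structure DualFeasible {C : ℕ} (τ : Instance) (α : ℕ → ℝ≥0) (β : Fin C → ℝ → ℝ≥0) : Prop where
  measurable : ∀ i, Measurable (β i)
  cover : ∀ j ∈ τ.jobs, ∀ i, ∀ t ∈ Icc (τ.type j).arrival (τ.type j).deadline,
    (τ.type j).value / (τ.type j).demand ≤ (α j : ℝ) + (β i t : ℝ)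

/-- The dual cost `∑_j D_j α_j + ∑_i ∫_0^∞ β_i(t) dt`. -/
def dualCost {C : ℕ} (τ : Instance) (α : ℕ → ℝ≥0) (β : Fin C → ℝ → ℝ≥0) : ℝ≥0∞ :=
  ∑ j ∈ τ.jobs, ENNReal.ofReal (τ.type j).demand * (α j : ℝ≥0∞) +
    ∑ i, ∫⁻ t in Ici (0 : ℝ), (β i t : ℝ≥0∞)

/-- `v(OPT*(τ))`: the optimal value of the dual program. -/
def fractionalOpt (C : ℕ) (τ : Instance) : ℝ≥0∞ :=
  ⨅ (α : ℕ → ℝ≥0) (β : Fin C → ℝ → ℝ≥0) (_ : DualFeasible τ α β), dualCost τ α β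

/-- `cr*_A(s)`: the worst ratio `v(OPT*(τ)) / v(A(τ))` over the instances of slackness `s`. -/
def fractionalRatio {C : ℕ} (A : Scheduler C) (s : ℝ) : ℝ≥0∞ :=
  ⨆ (τ : Instance) (_ : HasSlackness τ s), fractionalOpt C τ / value τ (A τ)

/-- `A` induces an upper bound on the integrality gap at slackness `s`: the optimal dual cost of
every instance of slackness `s` is at most `cr_A(s)` times the value gained by `A`. -/
def InducesIntegralityGapBound {C : ℕ} (A : Scheduler C) (s : ℝ) : Prop :=
  fractionalRatio A s ≤ competitiveRatio A s

/-- The virtual type `⟨v, D / ω, a, d - ω (d - a)⟩`. -/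
def JobType.virtual (ω : ℝ) (hω : 0 < ω) (T : JobType) : JobType where
  value := T.value
  demand := T.demand / ω
  arrival := T.arrival
  deadline := T.deadline - ω * (T.deadline - T.arrival)
  value_pos := T.value_pos
  demand_pos := div_pos T.demand_pos hω
  arrival_nonneg := T.arrival_nonneg

/-- The instance that is submitted to the simulator. -/
def Instance.virtual (ω : ℝ) (hω : 0 < ω) (τ : Instance) : Instance where
  jobs := τ.jobs
  type := fun j => (τ.type j).virtual ω hω

/-- A scheduler that announces decisions: `accepts τ j t` (`rejects τ j t`) says that, on input
`τ`, job `j` has been accepted (rejected) at time `t` or before. -/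
structure CommittedScheduler (C : ℕ) where
  run : Scheduler C
  accepts : Instance → ℕ → ℝ → Prop
  rejects : Instance → ℕ → ℝ → Prop

/-- `β`-responsiveness on inputs of slackness at least `s`: every job `j` is accepted or rejected
by time `d_j - β D_j`; decisions are made online and are final; accepted jobs are completed by
their deadlines whatever arrives later, and rejected jobs are not completed. -/
structure IsResponsive {C : ℕ} (R : CommittedScheduler C) (β s : ℝ) : Prop where
  causal : ∀ τ τ' t, AgreeUpTo t τ τ' → ∀ j ∈ τ.jobs, (τ.type j).arrival ≤ t →
    (R.accepts τ j t ↔ R.accepts τ' j t) ∧ (R.rejects τ j t ↔ R.rejects τ' j t)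
  accepts_final : ∀ τ, ∀ j ∈ τ.jobs, ∀ t t', t ≤ t' → R.accepts τ j t → R.accepts τ j t'
  rejects_final : ∀ τ, ∀ j ∈ τ.jobs, ∀ t t', t ≤ t' → R.rejects τ j t → R.rejects τ j t'
  exclusive : ∀ τ, ∀ j ∈ τ.jobs, ∀ t, ¬ (R.accepts τ j t ∧ R.rejects τ j t)
  decided : ∀ τ, SlacknessAtLeast τ s → ∀ j ∈ τ.jobs,
    R.accepts τ j ((τ.type j).deadline - β * (τ.type j).demand) ∨
      R.rejects τ j ((τ.type j).deadline - β * (τ.type j).demand)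
  completed_of_accepts : ∀ τ, SlacknessAtLeast τ s → ∀ j ∈ τ.jobs, ∀ t,
    R.accepts τ j t → Completed τ (R.run τ) j
  not_completed_of_rejects : ∀ τ, SlacknessAtLeast τ s → ∀ j ∈ τ.jobs, ∀ t,
    R.rejects τ j t → ¬ Completed τ (R.run τ) j

/-- Job `j` has been admitted to server `i` by time `t`: in the simulation of `A` on the virtual
types, virtual server `i` has completed `j` by time `t`. -/
def AdmittedBy {C : ℕ} (A : Scheduler C) (ω : ℝ) (hω : 0 < ω) (τ : Instance)
    (i : Fin C) (j : ℕ) (t : ℝ) : Prop :=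
  j ∈ τ.jobs ∧ CompletedOnBy (τ.virtual ω hω) (A (τ.virtual ω hω)) i j t

/-- At time `t`, job `j` is admitted to server `i`, and the schedule `σ` of the servers has not
yet processed it for `D_j` time units on that server. -/
def PendingAt {C : ℕ} (A : Scheduler C) (ω : ℝ) (hω : 0 < ω) (τ : Instance) (σ : Schedule C)
    (i : Fin C) (j : ℕ) (t : ℝ) : Prop :=
  AdmittedBy A ω hω τ i j t ∧ work σ i j t < ENNReal.ofReal (τ.type j).demand

/-- `R` is obtained from `A` by the simulation reduction with parameter `ω`. A job is accepted when
it is completed on a virtual server, and rejected at its virtual deadline if it has not been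
accepted. Every server `i` runs the earliest-deadline-first rule on the jobs admitted to it:
it is idle only if no job is pending, and otherwise processes a pending job of earliest deadline
(ties are broken in any measurable, online way). -/
structure IsReduction {C : ℕ} (A : Scheduler C) (ω : ℝ) (hω : 0 < ω)
    (R : CommittedScheduler C) : Prop where
  accepts_iff : ∀ τ, ∀ j ∈ τ.jobs, ∀ t, R.accepts τ j t ↔ ∃ i, AdmittedBy A ω hω τ i j t
  rejects_iff : ∀ τ, ∀ j ∈ τ.jobs, ∀ t, R.rejects τ j t ↔
    (((τ.virtual ω hω).type j).deadline ≤ t ∧ ¬ ∃ i, AdmittedBy A ω hω τ i j t)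
  measurable : ∀ τ, MeasurableSchedule (R.run τ)
  causal : Causal R.run
  idle : ∀ τ i t, R.run τ i t = none → ∀ j, ¬ PendingAt A ω hω τ (R.run τ) i j t
  edf : ∀ τ i t j, R.run τ i t = some j → PendingAt A ω hω τ (R.run τ) i j t ∧
    ∀ j', PendingAt A ω hω τ (R.run τ) i j' t → (τ.type j).deadline ≤ (τ.type j').deadline

end Sched

end

open Sched

namespace Sched

/-! Deadlines. Suppose a job admitted to a server is unfinished at its deadline `T`, and let `t₁` be
the supremum of the times up to `T` at which this server is not running a job with deadline at most
`T`. On `(t₁, T]` the server runs only jobs `k` with `d_k ≤ T` and virtual deadline at least `t₁`.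
For them `ω (d_k - a_k) ≤ d_k - t₁`, hence `ω (T - a_k) ≤ T - t₁`: the virtual server did all its
work on these jobs inside a window of length `(T - t₁) / ω` ending at `T`. Virtual demands are `D_k
/ ω`, so the true demands sum to at most `T - t₁`, and a server busy with these jobs throughout has
finished them all (`IsReduction.demand_le_work`). Hence true and virtual schedules complete the same
jobs and have the same value (`IsReduction.value_eq`).

Ratio. A dual solution of the virtual instance becomes one of the true instance at a cost larger by
a factor of at most `1 / (ω (1 - ω))` (`mul_opt_le_fractionalOpt_virtual`). Dividing by `ω` makes up
for the inflated demands. Extending `β` from virtual to true windows costs `1 / (1 - ω)`, because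
shortening intervals at the right by a factor shrinks their union by at most that factor
(`mul_volume_biUnion_Icc_le`), applied to every superlevel set. Weak duality bounds the integral
optimum.

Existence. In continuous time the earliest-deadline-first schedule is built by recursion on priority
instead of on time: each job uses the time left over by the jobs above it until its demand is met
(`edfPending`). -/

/-! ### Measure of a set of times up to a moving time -/

/-- The function is 1-Lipschitz; the lower bound on `S` keeps it finite. -/
theorem continuous_volume_inter_Iic {S : Set ℝ} (hS : S ⊆ Ici 0) :
    Continuous fun t : ℝ => volume (S ∩ Iic t) := by
  have hfin (t : ℝ) : volume (S ∩ Iic t) ≠ ∞ :=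
    ne_top_of_le_ne_top (measure_Icc_lt_top (a := (0 : ℝ)) (b := t)).ne
      (measure_mono fun u hu => ⟨hS hu.1, hu.2⟩)
  have hstep (t u : ℝ) :
      (volume (S ∩ Iic u)).toReal ≤ (volume (S ∩ Iic t)).toReal + |u - t| := by
    have h : volume (S ∩ Iic u) ≤ volume (S ∩ Iic t) + ENNReal.ofReal |u - t| := by
      calc volume (S ∩ Iic u) ≤ volume ((S ∩ Iic t) ∪ Ioc t u) := by
            refine measure_mono fun x hx => ?_
            by_cases h : x ≤ t
            · exact Or.inl ⟨hx.1, h⟩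
            · exact Or.inr ⟨not_le.1 h, hx.2⟩
        _ ≤ volume (S ∩ Iic t) + volume (Ioc t u) := measure_union_le _ _
        _ ≤ _ := by
            rw [Real.volume_Ioc]
            gcongr
            exact le_abs_self _
    have := ENNReal.toReal_mono (by simp [hfin]) h
    rwa [ENNReal.toReal_add (hfin t) ENNReal.ofReal_ne_top,
      ENNReal.toReal_ofReal (abs_nonneg _)] at this
  have hlip : LipschitzWith 1 fun t : ℝ => (volume (S ∩ Iic t)).toReal := by
    refine LipschitzWith.of_dist_le_mul fun x y => ?_
    rw [Real.dist_eq, Real.dist_eq, NNReal.coe_one, one_mul, abs_sub_le_iff]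
    have h1 := hstep y x
    have h2 := hstep x y
    rw [abs_sub_comm y x] at h2
    constructor <;> linarith
  have := ENNReal.continuous_ofReal.comp hlip.continuous
  refine this.congr fun t => ?_
  simp [ENNReal.ofReal_toReal (hfin t)]

theorem exists_volume_inter_Iic_eq {S : Set ℝ} (hS : S ⊆ Ici 0) {D : ℝ≥0∞} {t : ℝ}
    (h : D ≤ volume (S ∩ Iic t)) : ∃ u ≤ t, volume (S ∩ Iic u) = D := by
  have h0 : volume (S ∩ Iic (min t 0)) = 0 := by
    refine measure_mono_null (t := {0}) (fun u hu => ?_) (by simp)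
    exact le_antisymm (hu.2.trans (min_le_right _ _)) (hS hu.1)
  obtain ⟨u, hu, hD⟩ := intermediate_value_Icc (min_le_left t 0)
    (continuous_volume_inter_Iic hS).continuousOn ⟨h0.trans_le zero_le, h⟩
  exact ⟨u, hu.2, hD⟩

/-- A set in which every point has less than `D` of the set before it has measure at most `D`. -/
theorem volume_inter_Iic_le_of_forall_lt {S : Set ℝ} (hS : S ⊆ Ici 0) {D : ℝ≥0∞}
    (h : ∀ u ∈ S, volume (S ∩ Iic u) < D) (t : ℝ) : volume (S ∩ Iic t) ≤ D := by
  by_contra! hlt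
  obtain ⟨u, -, hu⟩ := exists_volume_inter_Iic_eq hS hlt.le
  -- A point of `S` beyond `u` would already have measure `D` before it, so `S ∩ Iic t` lies in `Iic
  -- u`.
  refine hlt.not_ge (hu ▸ measure_mono fun x hx => ⟨hx.1, ?_⟩)
  by_contra hxu
  have hux : u ≤ x := (not_le.1 hxu).le
  exact (h x hx.1).not_ge (hu ▸ measure_mono (inter_subset_inter_right _ (Iic_subset_Iic.2 hux)))

/-- Cutting `S` off once it has measure `D` leaves the measures below `D` unchanged. -/
theorem volume_truncation_lt_iff {S : Set ℝ} (hS : S ⊆ Ici 0) (D : ℝ≥0∞) (t : ℝ) :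
    volume ({u | u ∈ S ∧ volume (S ∩ Iic u) < D} ∩ Iic t) < D ↔ volume (S ∩ Iic t) < D := by
  refine ⟨fun h => ?_, fun h => ?_⟩
  swap
  · exact lt_of_le_of_lt (measure_mono (inter_subset_inter_left _ fun u hu => hu.1)) h
  by_contra! hD
  obtain ⟨u, hut, hu⟩ := exists_volume_inter_Iic_eq hS hD
  have hcl : IsClosed {x : ℝ | D ≤ volume (S ∩ Iic x)} :=
    isClosed_le continuous_const (continuous_volume_inter_Iic hS)
  rcases eq_or_ne D 0 with rfl | hD0
  · exact not_lt_zero h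
  have hbdd : BddBelow {x : ℝ | D ≤ volume (S ∩ Iic x)} := by
    refine ⟨0, fun x hx => ?_⟩
    by_contra! hx0
    have : S ∩ Iic x = ∅ := by
      ext y
      simp only [mem_inter_iff, mem_Iic, mem_empty_iff_false, iff_false, not_and, not_le]
      exact fun hy => hx0.trans_le (hS hy)
    exact hD0 (by simpa [this] using hx)
  -- The first time at which `S` has accumulated measure `D`: nothing is cut off before `m`, and the
  -- point `m` itself is null.
  set m := sInf {x : ℝ | D ≤ volume (S ∩ Iic x)}
  have hmem : D ≤ volume (S ∩ Iic m) := hcl.csInf_mem ⟨u, hu.ge⟩ hbdd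
  have hmt : m ≤ t := csInf_le hbdd hD
  have hsub : S ∩ Iic m ⊆ ({u | u ∈ S ∧ volume (S ∩ Iic u) < D} ∩ Iic t) ∪ {m} := by
    rintro x ⟨hxS, hxm⟩
    rcases (mem_Iic.1 hxm).eq_or_lt with rfl | hlt
    · exact Or.inr rfl
    · refine Or.inl ⟨⟨hxS, ?_⟩, hxm.trans hmt⟩
      by_contra! hx
      exact hlt.not_ge (csInf_le hbdd hx)
  refine h.not_ge (hmem.trans ((measure_mono hsub).trans ((measure_union_le _ _).trans ?_)))
  simp

/-! ### Admission in the simulation -/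

section Admission

variable {C : ℕ} {A : Scheduler C} {ω : ℝ} {hω : 0 < ω} {τ : Instance} {i : Fin C} {j : ℕ}

theorem AdmittedBy.mono {t t' : ℝ} (h : AdmittedBy A ω hω τ i j t) (htt' : t ≤ t') :
    AdmittedBy A ω hω τ i j t' :=
  ⟨h.1, h.2.trans (measure_mono fun _ hu => ⟨hu.1, hu.2.1.trans htt', hu.2.2⟩)⟩

/-- Only processing inside the virtual window counts, so admission happens by the virtual deadline
or never. -/
theorem AdmittedBy.by_virtual_deadline {t : ℝ} (h : AdmittedBy A ω hω τ i j t) :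
    AdmittedBy A ω hω τ i j ((τ.virtual ω hω).type j).deadline :=
  ⟨h.1, h.2.trans (measure_mono fun _ hu => ⟨hu.1, hu.1.2, hu.2.2⟩)⟩

theorem AdmittedBy.exists_processed {t : ℝ} (h : AdmittedBy A ω hω τ i j t) :
    ∃ u, A (τ.virtual ω hω) i u = some j := by
  by_contra! hne
  have h2 : ENNReal.ofReal (((τ.virtual ω hω).type j).demand) ≤ _ := h.2
  simp only [hne, and_false, ofPred_false, measure_empty, nonpos_iff_eq_zero,
    ENNReal.ofReal_eq_zero] at h2
  exact h2.not_gt ((τ.virtual ω hω).type j).demand_pos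

/-- A positive virtual demand does not fit into a single point of time. -/
theorem AdmittedBy.arrival_lt {t : ℝ} (h : AdmittedBy A ω hω τ i j t) :
    (τ.type j).arrival < t := by
  by_contra! hle
  have h2 : ENNReal.ofReal (((τ.virtual ω hω).type j).demand) ≤ _ := h.2
  refine (h2.trans (measure_mono (t := {(τ.type j).arrival}) fun u hu => ?_)).not_gt ?_
  · exact le_antisymm (hu.2.1.trans hle) hu.1.1
  · simpa using ((τ.virtual ω hω).type j).demand_pos

theorem AdmittedBy.server_unique (hmig : NonMigratory A) {i' : Fin C} {t t' : ℝ}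
    (h : AdmittedBy A ω hω τ i j t) (h' : AdmittedBy A ω hω τ i' j t') : i = i' := by
  obtain ⟨u, hu⟩ := h.exists_processed
  obtain ⟨u', hu'⟩ := h'.exists_processed
  exact hmig _ _ _ _ _ _ hu hu'

/-- Job types may have empty windows; admission rules this out. -/
theorem AdmittedBy.arrival_lt_deadline (hω1 : ω < 1) {t : ℝ} (h : AdmittedBy A ω hω τ i j t) :
    (τ.type j).arrival < (τ.type j).deadline := by
  have h1 : (τ.type j).arrival <
      (τ.type j).deadline - ω * ((τ.type j).deadline - (τ.type j).arrival) :=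
    h.by_virtual_deadline.arrival_lt
  nlinarith

theorem AgreeUpTo.mono {τ' : Instance} {t u : ℝ} (h : AgreeUpTo t τ τ') (hut : u ≤ t) :
    AgreeUpTo u τ τ' := by
  have hty : ∀ j ∈ τ.jobs, (τ.type j).arrival ≤ u → τ.type j = τ'.type j :=
    fun j hj ha => h.2 j hj (ha.trans hut)
  refine ⟨fun j => ⟨fun hj => ?_, fun hj => ?_⟩, hty⟩
  · exact ⟨((h.1 j).1 ⟨hj.1, hj.2.trans hut⟩).1, hty j hj.1 hj.2 ▸ hj.2⟩
  · have hj' := (h.1 j).2 ⟨hj.1, hj.2.trans hut⟩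
    exact ⟨hj'.1, (h.2 j hj'.1 hj'.2).symm ▸ hj.2⟩

theorem AgreeUpTo.symm {τ' : Instance} {t : ℝ} (h : AgreeUpTo t τ τ') : AgreeUpTo t τ' τ := by
  refine ⟨fun j => (h.1 j).symm, fun j hj ha => ?_⟩
  have hj' := (h.1 j).2 ⟨hj, ha⟩
  exact (h.2 j hj'.1 hj'.2).symm

theorem AgreeUpTo.virtual {τ' : Instance} {t : ℝ} (h : AgreeUpTo t τ τ') (hω : 0 < ω) :
    AgreeUpTo t (τ.virtual ω hω) (τ'.virtual ω hω) :=
  ⟨h.1, fun j hj ha => congrArg (JobType.virtual ω hω) (h.2 j hj ha)⟩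

/-- An admitted job has already arrived, so its type is shared by both instances; causality of `A`
makes the two virtual schedules agree up to `u`. -/
theorem AdmittedBy.of_agreeUpTo (hA : Causal A) {τ' : Instance} {t u : ℝ}
    (hττ' : AgreeUpTo t τ τ') (hut : u ≤ t) (h : AdmittedBy A ω hω τ i j u) :
    AdmittedBy A ω hω τ' i j u := by
  have ha : (τ.type j).arrival ≤ t := h.arrival_lt.le.trans hut
  refine ⟨((hττ'.1 j).1 ⟨h.1, ha⟩).1, ?_⟩
  have hty : (τ'.virtual ω hω).type j = (τ.virtual ω hω).type j :=
    congrArg (JobType.virtual ω hω) (hττ'.2 j h.1 ha).symm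
  have h2 := h.2
  unfold CompletedOnBy at h2 ⊢
  rw [hty]
  refine h2.trans (measure_mono fun x hx => ⟨hx.1, hx.2.1, ?_⟩)
  rw [← hA _ _ x ((hττ'.mono (hx.2.1.trans hut)).virtual hω)]
  exact hx.2.2

theorem admittedBy_congr (hA : Causal A) {τ' : Instance} {t u : ℝ}
    (hττ' : AgreeUpTo t τ τ') (hut : u ≤ t) :
    AdmittedBy A ω hω τ i j u ↔ AdmittedBy A ω hω τ' i j u :=
  ⟨fun h => h.of_agreeUpTo hA hττ' hut, fun h => h.of_agreeUpTo hA hττ'.symm hut⟩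

end Admission

/-! ### The committed schedule: deadlines, value and responsiveness -/

theorem work_eq_volume_inter {C : ℕ} (σ : Schedule C) (i : Fin C) (j : ℕ) (t : ℝ) :
    work σ i j t = volume ({u | σ i u = some j} ∩ Iic t) :=
  congrArg volume (by ext u; exact and_comm)

theorem work_mono {C : ℕ} (σ : Schedule C) (i : Fin C) (j : ℕ) : Monotone (work σ i j) :=
  fun _ _ h => measure_mono fun _ hu => ⟨hu.1.trans h, hu.2⟩

section Reduction

variable {C : ℕ} {A : Scheduler C} {ω : ℝ} {hω : 0 < ω} {R : CommittedScheduler C}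
  {τ : Instance} {i : Fin C} {j : ℕ}

theorem IsReduction.arrival_lt (hR : IsReduction A ω hω R) {t : ℝ}
    (h : R.run τ i t = some j) : (τ.type j).arrival < t :=
  (hR.edf τ i t j h).1.1.arrival_lt

theorem IsReduction.processed_subset_Ici (hR : IsReduction A ω hω R) :
    {t | R.run τ i t = some j} ⊆ Ici 0 :=
  fun _ hu => (τ.type j).arrival_nonneg.trans (hR.arrival_lt hu).le

theorem IsReduction.work_le (hR : IsReduction A ω hω R) (t : ℝ) :
    work (R.run τ) i j t ≤ ENNReal.ofReal (τ.type j).demand := by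
  rw [work_eq_volume_inter]
  refine volume_inter_Iic_le_of_forall_lt hR.processed_subset_Ici (fun u hu => ?_) t
  rw [← work_eq_volume_inter]
  exact (hR.edf τ i u j hu).1.2

/-- Every admitted job receives its whole demand by its deadline. -/
theorem IsReduction.demand_le_work (hR : IsReduction A ω hω R) (hA : IsOnline A) (hω1 : ω < 1)
    {t : ℝ} (h : AdmittedBy A ω hω τ i j t) :
    ENNReal.ofReal (τ.type j).demand ≤ work (R.run τ) i j (τ.type j).deadline := by
  classical
  by_contra! hlt
  set T := (τ.type j).deadline
  set σ := R.run τ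
  let vd : ℕ → ℝ := fun k => ((τ.virtual ω hω).type k).deadline
  have hvd (k : ℕ) : vd k =
      (τ.type k).deadline - ω * ((τ.type k).deadline - (τ.type k).arrival) := rfl
  have haT : (τ.type j).arrival < T := h.arrival_lt_deadline hω1
  have ha0 := (τ.type j).arrival_nonneg
  -- The times up to `T` at which the server is idle or runs a job due after `T`. By the EDF rule no
  -- job due by `T` is pending then.
  let B : Set ℝ := {u | u ≤ T ∧ ∀ k, σ i u = some k → T < (τ.type k).deadline}
  have hB : ∀ u ∈ B, ∀ k, (τ.type k).deadline ≤ T → ¬ PendingAt A ω hω τ σ i k u := by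
    intro u hu k hk hp
    rcases hcase : σ i u with _ | k'
    · exact hR.idle τ i u hcase k hp
    · exact ((hu.2 k' hcase).trans_le ((hR.edf τ i u k' hcase).2 k hp)).not_ge hk
  -- Nothing runs before time 0, so `B` is nonempty and its supremum is meaningful.
  have hBne : (-1 : ℝ) ∈ B := by
    refine ⟨by linarith, fun k hk => ?_⟩
    have h1 := hR.arrival_lt hk
    have h2 := (τ.type k).arrival_nonneg
    linarith
  -- A job unfinished at a time of `B` has not been admitted by then, so its virtual deadline cannot
  -- have passed.
  have hBvd : ∀ k, (τ.type k).deadline ≤ T → (∃ t, AdmittedBy A ω hω τ i k t) → ∀ u ∈ B,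
      work σ i k u < ENNReal.ofReal (τ.type k).demand → u ≤ vd k := by
    rintro k hk ⟨t, ht⟩ u hu hw
    by_contra! hlt'
    exact hB u hu k hk ⟨ht.by_virtual_deadline.mono hlt'.le, hw⟩
  have hBdd : BddAbove B := ⟨T, fun u hu => hu.1⟩
  set t₁ := sSup B
  let K := τ.jobs.filter fun k =>
    (∃ t, AdmittedBy A ω hω τ i k t) ∧ (τ.type k).deadline ≤ T ∧ t₁ ≤ vd k
  have hjK : j ∈ K := by
    refine Finset.mem_filter.2 ⟨h.1, ⟨t, h⟩, le_rfl, csSup_le ⟨_, hBne⟩ fun u hu => ?_⟩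
    exact hBvd j le_rfl ⟨t, h⟩ u hu ((work_mono σ i j hu.1).trans_lt hlt)
  have hbusy : Ioc t₁ T ⊆ ⋃ k ∈ K, {x | x ≤ T ∧ σ i x = some k} := by
    intro u hu
    have huB : u ∉ B := fun huB => hu.1.not_ge (le_csSup hBdd huB)
    have : ∃ k, σ i u = some k ∧ (τ.type k).deadline ≤ T := by
      by_contra! hne
      exact huB ⟨hu.2, hne⟩
    obtain ⟨k, hk, hkT⟩ := this
    obtain ⟨hadm, hw⟩ := (hR.edf τ i u k hk).1
    refine mem_biUnion (x := k) ?_ ⟨hu.2, hk⟩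
    refine Finset.mem_coe.2 (Finset.mem_filter.2
      ⟨hadm.1, ⟨u, hadm⟩, hkT, csSup_le ⟨_, hBne⟩ fun b hb => ?_⟩)
    exact hBvd k hkT ⟨u, hadm⟩ b hb
      ((work_mono σ i k ((le_csSup hBdd hb).trans hu.1.le)).trans_lt hw)
  -- The busy period is filled by jobs of `K`. None receives more than its demand, and `j` receives
  -- strictly less.
  have hreal : ENNReal.ofReal (T - t₁) < ∑ k ∈ K, ENNReal.ofReal (τ.type k).demand := by
    calc ENNReal.ofReal (T - t₁) = volume (Ioc t₁ T) := Real.volume_Ioc.symm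
      _ ≤ ∑ k ∈ K, work σ i k T := (measure_mono hbusy).trans (measure_biUnion_finset_le _ _)
      _ = work σ i j T + ∑ k ∈ K.erase j, work σ i k T := (Finset.add_sum_erase _ _ hjK).symm
      _ < ENNReal.ofReal (τ.type j).demand +
            ∑ k ∈ K.erase j, ENNReal.ofReal (τ.type k).demand := by
          refine ENNReal.add_lt_add_of_lt_of_le ?_ hlt (Finset.sum_le_sum fun k _ => hR.work_le T)
          exact ENNReal.sum_ne_top.2 fun k _ => ne_top_of_le_ne_top ENNReal.ofReal_ne_top
            (hR.work_le T)
      _ = _ := Finset.add_sum_erase K (fun k => ENNReal.ofReal (τ.type k).demand) hjK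
  -- The virtual server completed every job of `K`, at disjoint times inside one window of length
  -- `(T - t₁) / ω`.
  have hvirt : ∑ k ∈ K, ENNReal.ofReal ((τ.type k).demand / ω) ≤
      ENNReal.ofReal ((T - t₁) / ω) := by
    let V : ℕ → Set ℝ := fun k => {u | A (τ.virtual ω hω) i u = some k}
    have hVm (k : ℕ) : MeasurableSet (V k) := (hA.feasible _).measurable i k
    have hdisj : (K : Set ℕ).PairwiseDisjoint V := fun k _ k' _ hkk' =>
      disjoint_left.2 fun u (hu : _ = _) (hu' : _ = _) => hkk' (by simpa [hu] using hu')
    calc ∑ k ∈ K, ENNReal.ofReal ((τ.type k).demand / ω) ≤ ∑ k ∈ K, volume (V k) := by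
          refine Finset.sum_le_sum fun k hk => ?_
          obtain ⟨-, ⟨u, hu⟩, -⟩ := Finset.mem_filter.1 hk
          exact hu.2.trans (measure_mono fun x hx => hx.2.2)
      _ = volume (⋃ k ∈ K, V k) := (measure_biUnion_finset hdisj fun k _ => hVm k).symm
      _ ≤ volume (Icc (T - (T - t₁) / ω) T) := by
          refine measure_mono (iUnion₂_subset fun k hk u hu => ?_)
          obtain ⟨-, ⟨t', ht'⟩, hkT, hkt⟩ := Finset.mem_filter.1 hk
          obtain ⟨-, hua, hud⟩ := (hA.feasible _).window i u k hu
          change (τ.type k).arrival ≤ u at hua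
          change u ≤ vd k at hud
          have hlt' := ht'.arrival_lt_deadline hω1
          rw [hvd] at hkt hud
          constructor
          · have h1 : T - (τ.type k).arrival ≤ (T - t₁) / ω := by
              rw [le_div_iff₀ hω]
              nlinarith
            linarith
          · nlinarith
      _ = ENNReal.ofReal ((T - t₁) / ω) := by rw [Real.volume_Icc]; congr 1; ring
  rw [← ENNReal.ofReal_sum_of_nonneg fun k _ => (τ.type k).demand_pos.le] at hreal
  rw [← ENNReal.ofReal_sum_of_nonneg fun k _ => (div_pos (τ.type k).demand_pos hω).le,
    ← Finset.sum_div] at hvirt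
  have hle : t₁ ≤ T := csSup_le ⟨_, hBne⟩ fun u hu => hu.1
  rw [ENNReal.ofReal_le_ofReal_iff (div_nonneg (sub_nonneg.2 hle) hω.le),
    div_le_div_iff_of_pos_right hω] at hvirt
  exact hreal.not_ge (ENNReal.ofReal_le_ofReal hvirt)

theorem IsReduction.feasible (hR : IsReduction A ω hω R) (hA : IsOnline A)
    (hmig : NonMigratory A) (hω1 : ω < 1) (τ : Instance) : Feasible τ (R.run τ) where
  measurable := hR.measurable τ
  window i t j h := by
    obtain ⟨hadm, hw⟩ := (hR.edf τ i t j h).1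
    refine ⟨hadm.1, hadm.arrival_lt.le, ?_⟩
    by_contra! hlt
    exact ((hR.demand_le_work hA hω1 hadm).trans (work_mono _ i j hlt.le)).not_gt hw
  one_server i i' t j h h' :=
    (hR.edf τ i t j h).1.1.server_unique hmig (hR.edf τ i' t j h').1.1

theorem IsReduction.nonMigratory (hR : IsReduction A ω hω R) (hmig : NonMigratory A) :
    NonMigratory R.run := fun τ i i' t t' j h h' =>
  (hR.edf τ i t j h).1.1.server_unique hmig (hR.edf τ i' t' j h').1.1

theorem IsReduction.completed_iff (hR : IsReduction A ω hω R) (hA : IsOnline A)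
    (hω1 : ω < 1) :
    Completed τ (R.run τ) j ↔ ∃ i t, AdmittedBy A ω hω τ i j t := by
  constructor
  · intro h
    by_contra! hne
    have hempty (i : Fin C) : {u : ℝ | u ∈ Icc (τ.type j).arrival (τ.type j).deadline ∧
        R.run τ i u = some j} = ∅ :=
      eq_empty_of_forall_notMem fun u hu => hne i u (hR.edf τ i u j hu.2).1.1
    simp only [Completed, hempty, measure_empty, Finset.sum_const_zero, nonpos_iff_eq_zero,
      ENNReal.ofReal_eq_zero] at h
    exact h.not_gt (τ.type j).demand_pos
  · rintro ⟨i, t, h⟩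
    refine (hR.demand_le_work hA hω1 h).trans (le_trans (measure_mono ?_)
      (Finset.single_le_sum (f := fun i => volume {u : ℝ |
        u ∈ Icc (τ.type j).arrival (τ.type j).deadline ∧ R.run τ i u = some j})
        (fun _ _ => zero_le) (Finset.mem_univ i)))
    exact fun u hu => ⟨⟨(hR.arrival_lt hu.2).le, hu.1⟩, hu.2⟩

theorem completed_virtual_iff (hmig : NonMigratory A) (hj : j ∈ τ.jobs) :
    Completed (τ.virtual ω hω) (A (τ.virtual ω hω)) j ↔ ∃ i t, AdmittedBy A ω hω τ i j t := by
  constructor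
  · intro h
    have hpos : (0 : ℝ≥0∞) < ENNReal.ofReal (((τ.virtual ω hω).type j).demand) :=
      ENNReal.ofReal_pos.2 ((τ.virtual ω hω).type j).demand_pos
    obtain ⟨i, -, hi⟩ := Finset.exists_ne_zero_of_sum_ne_zero (hpos.trans_le h).ne'
    obtain ⟨u, -, hu⟩ := nonempty_of_measure_ne_zero hi
    refine ⟨i, ((τ.virtual ω hω).type j).deadline, hj, h.trans ?_⟩
    -- Without migration only the server `i` that touches the job contributes to its processing
    -- time.
    rw [Finset.sum_eq_single i]
    · exact measure_mono fun x hx => ⟨hx.1, hx.1.2, hx.2⟩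
    · intro i' _ hne
      refine measure_mono_null (t := ∅) (fun x hx => ?_) measure_empty
      exact hne (hmig _ _ _ _ _ _ hx.2 hu)
    · simp
  · rintro ⟨i, t, h⟩
    refine h.2.trans (le_trans (measure_mono ?_)
      (Finset.single_le_sum (f := fun i => volume {u : ℝ |
        u ∈ Icc ((τ.virtual ω hω).type j).arrival ((τ.virtual ω hω).type j).deadline ∧
          A (τ.virtual ω hω) i u = some j}) (fun _ _ => zero_le) (Finset.mem_univ i)))
    exact fun u hu => ⟨hu.1, hu.2.2⟩

/-- On both sides the completed jobs are exactly the admitted ones, and virtual types keep the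
values. -/
theorem IsReduction.value_eq (hR : IsReduction A ω hω R) (hA : IsOnline A)
    (hmig : NonMigratory A) (hω1 : ω < 1) (τ : Instance) :
    value τ (R.run τ) = value (τ.virtual ω hω) (A (τ.virtual ω hω)) := by
  classical
  unfold value
  refine Finset.sum_congr (Finset.filter_congr fun j hj => ?_) fun _ _ => rfl
  rw [hR.completed_iff hA hω1, completed_virtual_iff hmig hj]

theorem IsReduction.isResponsive (hR : IsReduction A ω hω R) (hA : IsOnline A)
    (hω1 : ω < 1) (s : ℝ) : IsResponsive R (ω * s) s where
  causal τ τ' t hττ' j hj ha := by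
    have hj' := ((hττ'.1 j).1 ⟨hj, ha⟩).1
    have hex : (∃ i, AdmittedBy A ω hω τ i j t) ↔ ∃ i, AdmittedBy A ω hω τ' i j t :=
      exists_congr fun i => admittedBy_congr hA.causal hττ' le_rfl
    have hty : (τ.virtual ω hω).type j = (τ'.virtual ω hω).type j :=
      congrArg (JobType.virtual ω hω) (hττ'.2 j hj ha)
    rw [hR.accepts_iff τ j hj, hR.accepts_iff τ' j hj', hR.rejects_iff τ j hj,
      hR.rejects_iff τ' j hj', hex, hty]
    exact ⟨Iff.rfl, Iff.rfl⟩
  accepts_final τ j hj t t' htt' h := by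
    rw [hR.accepts_iff τ j hj] at h ⊢
    exact h.imp fun i hi => hi.mono htt'
  rejects_final τ j hj t t' htt' h := by
    rw [hR.rejects_iff τ j hj] at h ⊢
    exact ⟨h.1.trans htt', fun ⟨i, hi⟩ => h.2 ⟨i, hi.by_virtual_deadline.mono h.1⟩⟩
  exclusive τ j hj t h := by
    rw [hR.accepts_iff τ j hj, hR.rejects_iff τ j hj] at h
    exact h.2.2 h.1
  decided τ hs j hj := by
    rw [hR.accepts_iff τ j hj, hR.rejects_iff τ j hj]
    refine or_iff_not_imp_left.2 fun h => ⟨?_, h⟩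
    change (τ.type j).deadline - ω * ((τ.type j).deadline - (τ.type j).arrival) ≤ _
    -- `ω (d - a) ≥ ω s D`, so the virtual deadline is at most `d - ω s D`.
    have := mul_le_mul_of_nonneg_left (hs j hj) hω.le
    linarith
  completed_of_accepts τ _ j hj t h := by
    obtain ⟨i, hi⟩ := (hR.accepts_iff τ j hj t).1 h
    exact (hR.completed_iff hA hω1).2 ⟨i, t, hi⟩
  not_completed_of_rejects τ _ j hj t h hc := by
    obtain ⟨hle, hne⟩ := (hR.rejects_iff τ j hj t).1 h
    obtain ⟨i, t', hi⟩ := (hR.completed_iff hA hω1).1 hc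
    exact hne ⟨i, hi.by_virtual_deadline.mono hle⟩

end Reduction

/-! ### Construction of an online earliest-deadline-first schedule -/

section Existence

/-- The earliest-deadline-first priority, ties being broken by the label. -/
noncomputable def Instance.priority (τ : Instance) (j : ℕ) : ℝ ×ₗ ℕ := toLex ((τ.type j).deadline, j)

theorem Instance.priority_injective (τ : Instance) : Function.Injective τ.priority :=
  fun _ _ h => congrArg Prod.snd (toLex.injective h)

theorem Instance.deadline_le_of_priority_le {τ : Instance} {j k : ℕ}
    (h : τ.priority j ≤ τ.priority k) : (τ.type j).deadline ≤ (τ.type k).deadline := by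
  rcases Prod.Lex.le_iff.1 h with h | h
  · exact h.le
  · exact h.1.le

/-- The jobs of higher priority than `j`. -/
noncomputable def Instance.higher (τ : Instance) (j : ℕ) : Finset ℕ :=
  τ.jobs.filter fun k => τ.priority k < τ.priority j

theorem Instance.mem_higher {τ : Instance} {j k : ℕ} :
    k ∈ τ.higher j ↔ k ∈ τ.jobs ∧ τ.priority k < τ.priority j := Finset.mem_filter

theorem Instance.card_higher_lt {τ : Instance} {j k : ℕ} (h : k ∈ τ.higher j) :
    (τ.higher k).card < (τ.higher j).card := by
  refine Finset.card_lt_card ((Finset.ssubset_iff_of_subset fun l hl => ?_).2 ⟨k, h, ?_⟩)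
  · exact mem_higher.2 ⟨(mem_higher.1 hl).1, (mem_higher.1 hl).2.trans (mem_higher.1 h).2⟩
  · exact fun hk => (mem_higher.1 hk).2.false

variable {C : ℕ} (A : Scheduler C) (ω : ℝ) (hω : 0 < ω) (τ : Instance) (i : Fin C)

/-- The times at which job `j` is pending on server `i` when the jobs admitted to the server are
run in the order of their priorities. -/
noncomputable def edfPending (j : ℕ) : Set ℝ :=
  {t | AdmittedBy A ω hω τ i j t ∧
    volume ({u | AdmittedBy A ω hω τ i j u ∧ ∀ k, ∀ _ : k ∈ τ.higher j, u ∉ edfPending k} ∩ Iic t)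
      < ENNReal.ofReal (τ.type j).demand}
termination_by (τ.higher j).card
decreasing_by exact Instance.card_higher_lt ‹_›

/-- The times at which job `j` is admitted to server `i` and no job of higher priority is
pending. -/
noncomputable def edfAvailable (j : ℕ) : Set ℝ :=
  {u | AdmittedBy A ω hω τ i j u ∧ ∀ k ∈ τ.higher j, u ∉ edfPending A ω hω τ i k}

theorem mem_edfPending {j : ℕ} {t : ℝ} : t ∈ edfPending A ω hω τ i j ↔
    AdmittedBy A ω hω τ i j t ∧
      volume (edfAvailable A ω hω τ i j ∩ Iic t) < ENNReal.ofReal (τ.type j).demand := by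
  rw [edfPending]
  rfl

open Classical in
/-- The priority-driven earliest-deadline-first schedule. -/
noncomputable def edfSchedule : Schedule C := fun i t =>
  if h : ∃ j ∈ τ.jobs, t ∈ edfPending A ω hω τ i j ∧ ∀ k ∈ τ.higher j, t ∉ edfPending A ω hω τ i k
  then some h.choose else none

variable {A ω hω τ i}

theorem edfAvailable_subset_Ici {j : ℕ} : edfAvailable A ω hω τ i j ⊆ Ici 0 :=
  fun _ hu => (τ.type j).arrival_nonneg.trans hu.1.arrival_lt.le

theorem edfSchedule_eq_some_iff {j : ℕ} {t : ℝ} : edfSchedule A ω hω τ i t = some j ↔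
    t ∈ edfPending A ω hω τ i j ∧ ∀ k ∈ τ.higher j, t ∉ edfPending A ω hω τ i k := by
  -- Two jobs that are both pending and unobstructed bound each other's priority, so the chosen job
  -- is unique by injectivity.
  have key : ∀ j ∈ τ.jobs, ∀ j' ∈ τ.jobs,
      (t ∈ edfPending A ω hω τ i j ∧ ∀ k ∈ τ.higher j, t ∉ edfPending A ω hω τ i k) →
      (t ∈ edfPending A ω hω τ i j' ∧ ∀ k ∈ τ.higher j', t ∉ edfPending A ω hω τ i k) →
      τ.priority j ≤ τ.priority j' := by
    intro j _ j' hj' h h'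
    by_contra! hlt
    exact h.2 j' (Instance.mem_higher.2 ⟨hj', hlt⟩) h'.1
  unfold edfSchedule
  constructor
  · intro h
    split_ifs at h with hex
    obtain rfl := Option.some.inj h
    exact hex.choose_spec.2
  · intro h
    have hj : j ∈ τ.jobs := ((mem_edfPending A ω hω τ i).1 h.1).1.1
    have hex : ∃ j ∈ τ.jobs, t ∈ edfPending A ω hω τ i j ∧
      ∀ k ∈ τ.higher j, t ∉ edfPending A ω hω τ i k := ⟨j, hj, h⟩
    rw [dif_pos hex]
    have hs := hex.choose_spec
    exact congrArg some (τ.priority_injective (le_antisymm (key _ hs.1 _ hj hs.2 h)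
      (key _ hj _ hs.1 h hs.2)))

theorem setOf_edfSchedule_eq (j : ℕ) : {t | edfSchedule A ω hω τ i t = some j} =
    {t | t ∈ edfAvailable A ω hω τ i j ∧
      volume (edfAvailable A ω hω τ i j ∩ Iic t) < ENNReal.ofReal (τ.type j).demand} := by
  ext t
  simp only [mem_ofPred_eq, edfSchedule_eq_some_iff, mem_edfPending A ω hω τ i (j := j)]
  exact ⟨fun h => ⟨⟨h.1.1, h.2⟩, h.1.2⟩, fun h => ⟨⟨h.1.1, h.2⟩, h.1.2⟩⟩

/-- The recursion measures available time, `PendingAt` measures processed time. The latter is the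
former cut off at measure `D`, so both are below `D` at the same times. -/
theorem mem_edfPending_iff_pendingAt {j : ℕ} {t : ℝ} : t ∈ edfPending A ω hω τ i j ↔
    PendingAt A ω hω τ (edfSchedule A ω hω τ) i j t := by
  rw [mem_edfPending, PendingAt, work_eq_volume_inter, setOf_edfSchedule_eq,
    volume_truncation_lt_iff edfAvailable_subset_Ici]

theorem measurableSet_admittedBy (j : ℕ) : MeasurableSet {t | AdmittedBy A ω hω τ i j t} :=
  OrdConnected.measurableSet ⟨fun _ hx _ _ _ hz => AdmittedBy.mono hx hz.1⟩

theorem measurableSet_edfPending (j : ℕ) : MeasurableSet (edfPending A ω hω τ i j) := by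
  have h : edfPending A ω hω τ i j = {t | AdmittedBy A ω hω τ i j t} ∩
      {t | volume (edfAvailable A ω hω τ i j ∩ Iic t) < ENNReal.ofReal (τ.type j).demand} := by
    ext t
    exact mem_edfPending A ω hω τ i
  rw [h]
  exact (measurableSet_admittedBy j).inter
    (isOpen_lt (continuous_volume_inter_Iic edfAvailable_subset_Ici)
      continuous_const).measurableSet

theorem measurableSchedule_edfSchedule : MeasurableSchedule (edfSchedule A ω hω τ) := by
  intro i j
  have h : {t | edfSchedule A ω hω τ i t = some j} =
      edfPending A ω hω τ i j ∩ ⋂ k ∈ τ.higher j, (edfPending A ω hω τ i k)ᶜ := by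
    ext t
    simp [edfSchedule_eq_some_iff]
  rw [h]
  exact (measurableSet_edfPending j).inter
    (Finset.measurableSet_biInter _ fun k _ => (measurableSet_edfPending k).compl)

theorem edfSchedule_idle {t : ℝ} (h : edfSchedule A ω hω τ i t = none) (j : ℕ) :
    t ∉ edfPending A ω hω τ i j := by
  classical
  intro hj
  let P := τ.jobs.filter fun k => t ∈ edfPending A ω hω τ i k
  have hmem : j ∈ P := Finset.mem_filter.2 ⟨((mem_edfPending A ω hω τ i).1 hj).1.1, hj⟩
  obtain ⟨k, hk, hmin⟩ := P.exists_min_image τ.priority ⟨j, hmem⟩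
  have : edfSchedule A ω hω τ i t = some k := by
    refine edfSchedule_eq_some_iff.2 ⟨(Finset.mem_filter.1 hk).2, fun l hl hlt => ?_⟩
    obtain ⟨hl1, hl2⟩ := Instance.mem_higher.1 hl
    exact (hmin l (Finset.mem_filter.2 ⟨hl1, hlt⟩)).not_gt hl2
  simp [h] at this

theorem AgreeUpTo.priority_eq {τ' : Instance} {t : ℝ} (h : AgreeUpTo t τ τ') {j : ℕ}
    (hj : j ∈ τ.jobs) (ha : (τ.type j).arrival ≤ t) : τ.priority j = τ'.priority j := by
  unfold Instance.priority
  rw [h.2 j hj ha]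

/-- The clearance condition of the priority rule carries over to an instance with the same
arrivals. -/
theorem higher_clear_of_agreeUpTo {τ' : Instance} {t u : ℝ} (h : AgreeUpTo t τ τ') (hut : u ≤ t)
    {j : ℕ} (hj : j ∈ τ.jobs) (ha : (τ.type j).arrival ≤ t)
    (hpend : ∀ k ∈ τ.jobs, τ.priority k < τ.priority j → (τ.type k).arrival ≤ t →
      (u ∈ edfPending A ω hω τ i k ↔ u ∈ edfPending A ω hω τ' i k)) :
    (∀ k ∈ τ.higher j, u ∉ edfPending A ω hω τ i k) ↔
      ∀ k ∈ τ'.higher j, u ∉ edfPending A ω hω τ' i k := by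
  constructor
  · intro hc k hk hu
    -- A pending job is admitted, hence has arrived by `t` and is known to both instances.
    have hka := ((mem_edfPending A ω hω τ' i).1 hu).1.arrival_lt.le.trans hut
    obtain ⟨hk1, hk2⟩ := Instance.mem_higher.1 hk
    obtain ⟨hk1', hka'⟩ := (h.1 k).2 ⟨hk1, hka⟩
    rw [← h.priority_eq hk1' hka', ← h.priority_eq hj ha] at hk2
    exact hc k (Instance.mem_higher.2 ⟨hk1', hk2⟩) ((hpend k hk1' hk2 hka').2 hu)
  · intro hc k hk hu
    have hka := ((mem_edfPending A ω hω τ i).1 hu).1.arrival_lt.le.trans hut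
    obtain ⟨hk1, hk2⟩ := Instance.mem_higher.1 hk
    have hu' := (hpend k hk1 hk2 hka).1 hu
    rw [h.priority_eq hk1 hka, h.priority_eq hj ha] at hk2
    exact hc k (Instance.mem_higher.2 ⟨((h.1 k).1 ⟨hk1, hka⟩).1, hk2⟩) hu'

/-- Induction on the number of jobs of higher priority. It runs over all `u ≤ t` at once, since the
time used up by `u` depends on pendency at all earlier times. -/
theorem edfPending_congr (hA : Causal A) {τ' : Instance} {t : ℝ} (h : AgreeUpTo t τ τ') (j : ℕ)
    (hj : j ∈ τ.jobs) (ha : (τ.type j).arrival ≤ t) (u : ℝ) (hut : u ≤ t) :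
    u ∈ edfPending A ω hω τ i j ↔ u ∈ edfPending A ω hω τ' i j := by
  induction hn : (τ.higher j).card using Nat.strong_induction_on generalizing j u with
  | _ n ih =>
    have hset : edfAvailable A ω hω τ i j ∩ Iic u = edfAvailable A ω hω τ' i j ∩ Iic u := by
      ext x
      refine and_congr_left fun hx => ?_
      have hxt : x ≤ t := le_trans hx hut
      refine and_congr (admittedBy_congr hA h hxt) (higher_clear_of_agreeUpTo h hxt hj ha ?_)
      intro k hk hkj hka
      exact ih _ (hn ▸ Instance.card_higher_lt (Instance.mem_higher.2 ⟨hk, hkj⟩)) k hk hka x hxt rfl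
    rw [mem_edfPending, mem_edfPending, hset, admittedBy_congr hA h hut, h.2 j hj ha]

theorem causal_edfSchedule (hA : Causal A) : Causal fun τ => edfSchedule A ω hω τ := by
  have key : ∀ τ τ' t, AgreeUpTo t τ τ' → ∀ i j, edfSchedule A ω hω τ i t = some j →
      edfSchedule A ω hω τ' i t = some j := by
    intro τ τ' t h i j hj
    rw [edfSchedule_eq_some_iff] at hj ⊢
    have hadm := ((mem_edfPending A ω hω τ i).1 hj.1).1
    have ha := hadm.arrival_lt.le
    exact ⟨(edfPending_congr hA h j hadm.1 ha t le_rfl).1 hj.1,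
      (higher_clear_of_agreeUpTo h le_rfl hadm.1 ha fun k hk _ hka =>
        edfPending_congr hA h k hk hka t le_rfl).1 hj.2⟩
  intro τ τ' t h i
  exact Option.ext fun j => ⟨key τ τ' t h i j, key τ' τ t h.symm i j⟩

theorem exists_isReduction (hA : Causal A) : ∃ R : CommittedScheduler C, IsReduction A ω hω R :=
  ⟨{ run := fun τ => edfSchedule A ω hω τ
     accepts := fun τ j t => ∃ i, AdmittedBy A ω hω τ i j t
     rejects := fun τ j t => ((τ.virtual ω hω).type j).deadline ≤ t ∧
      ¬ ∃ i, AdmittedBy A ω hω τ i j t },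
   { accepts_iff := fun _ _ _ _ => Iff.rfl
     rejects_iff := fun _ _ _ _ => Iff.rfl
     measurable := fun _ => measurableSchedule_edfSchedule
     causal := causal_edfSchedule hA
     idle := fun _ _ _ h j hj => edfSchedule_idle h j (mem_edfPending_iff_pendingAt.2 hj)
     edf := fun τ i t j h => by
      obtain ⟨h1, h2⟩ := edfSchedule_eq_some_iff.1 h
      refine ⟨mem_edfPending_iff_pendingAt.1 h1, fun j' hj' =>
        Instance.deadline_le_of_priority_le (not_lt.1 fun hlt => ?_)⟩
      exact h2 j' (Instance.mem_higher.2 ⟨hj'.1.1, hlt⟩) (mem_edfPending_iff_pendingAt.2 hj') }⟩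

end Existence

/-! ### Weak duality and shortened windows -/

/-- Weak duality: a completed job pays for its value with `D_j α_j` and the integral of `β` over its
processing times, and these times are disjoint on each server. -/
theorem DualFeasible.opt_le_dualCost {C : ℕ} {τ : Instance} {α : ℕ → ℝ≥0}
    {β : Fin C → ℝ → ℝ≥0} (h : DualFeasible τ α β) : opt C τ ≤ dualCost τ α β := by
  classical
  refine iSup₂_le fun σ hσ => ?_
  let P : Fin C → ℕ → Set ℝ := fun i j => {t | σ i t = some j}
  have hPm (i : Fin C) (j : ℕ) : MeasurableSet (P i j) := hσ.measurable i j
  have hjob : ∀ j ∈ τ.jobs, Completed τ σ j → ENNReal.ofReal (τ.type j).value ≤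
      ENNReal.ofReal (τ.type j).demand * α j + ∑ i, ∫⁻ t in P i j, β i t := by
    intro j hj hc
    set v := (τ.type j).value
    set D := (τ.type j).demand
    have hD : 0 < D := (τ.type j).demand_pos
    -- The part of the density `v / D` not covered by `α j`; it is at most `β i t` whenever `i`
    -- processes `j`.
    let c : ℝ≥0 := (v / D - α j).toNNReal
    have hβ (i : Fin C) : (c : ℝ≥0∞) * volume (P i j) ≤ ∫⁻ t in P i j, β i t := by
      rw [← setLIntegral_const]
      refine setLIntegral_mono' (hPm i j) fun t ht => ENNReal.coe_le_coe.2 ?_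
      have := h.cover j hj i t (hσ.window i t j ht).2
      exact Real.toNNReal_le_iff_le_coe.2 (by linarith)
    calc ENNReal.ofReal v ≤ ENNReal.ofReal (D * (α j + c)) := by
          refine ENNReal.ofReal_le_ofReal ?_
          have h1 : v / D - α j ≤ c := Real.le_coe_toNNReal _
          rw [mul_comm, ← div_le_iff₀ hD]
          linarith
      _ = ENNReal.ofReal D * α j + c * ENNReal.ofReal D := by
          rw [ENNReal.ofReal_mul hD.le, ENNReal.ofReal_add (α j).coe_nonneg c.coe_nonneg, ENNReal.ofReal_coe_nnreal,
            ENNReal.ofReal_coe_nnreal, mul_add, mul_comm (c : ℝ≥0∞)]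
      _ ≤ ENNReal.ofReal D * α j + c * ∑ i, volume (P i j) := by
          gcongr
          exact hc.trans (Finset.sum_le_sum fun i _ => measure_mono fun u hu => hu.2)
      _ ≤ _ := by
          rw [Finset.mul_sum]
          gcongr
          exact hβ _
  calc value τ σ
      ≤ ∑ j ∈ τ.jobs with Completed τ σ j,
          (ENNReal.ofReal (τ.type j).demand * α j + ∑ i, ∫⁻ t in P i j, β i t) := by
        unfold value
        convert Finset.sum_le_sum fun j hj =>
          hjob j (Finset.mem_filter.1 hj).1 (Finset.mem_filter.1 hj).2
    _ ≤ ∑ j ∈ τ.jobs, (ENNReal.ofReal (τ.type j).demand * α j + ∑ i, ∫⁻ t in P i j, β i t) :=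
        Finset.sum_le_sum_of_subset (Finset.filter_subset _ _)
    _ = ∑ j ∈ τ.jobs, ENNReal.ofReal (τ.type j).demand * α j +
          ∑ i, ∑ j ∈ τ.jobs, ∫⁻ t in P i j, β i t := by
        rw [Finset.sum_add_distrib, Finset.sum_comm (s := τ.jobs)]
    _ ≤ dualCost τ α β := by
        unfold dualCost
        refine add_le_add_right (Finset.sum_le_sum fun i _ => ?_) _
        have hdisj : (τ.jobs : Set ℕ).PairwiseDisjoint (P i) := fun j _ j' _ hne =>
          disjoint_left.2 fun t (ht : _ = _) (ht' : _ = _) => hne (by simpa [ht] using ht')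
        rw [← lintegral_biUnion_finset hdisj fun j _ => hPm i j]
        refine lintegral_mono_set (iUnion₂_subset fun j _ t ht => ?_)
        exact (τ.type j).arrival_nonneg.trans (hσ.window i t j ht).2.1

/-- Shortening the intervals `[a j, d j]` at their right ends by a factor `l` shrinks the measure
of their union, on every half-line, by at most the factor `l`. -/
theorem mul_volume_biUnion_Icc_inter_le (a d : ℕ → ℝ) {l : ℝ} (hl0 : 0 ≤ l) (hl1 : l ≤ 1)
    (S : Finset ℕ) (x : ℝ) :
    ENNReal.ofReal l * volume ((⋃ j ∈ S, Icc (a j) (d j)) ∩ Iic x) ≤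
      volume ((⋃ j ∈ S, Icc (a j) (a j + l * (d j - a j))) ∩ Iic x) := by
  -- Intervals are added in order of right endpoint. To the right of `a j` the new interval then
  -- covers the whole union, and to the left the induction hypothesis applies on the half-line `Iic
  -- (a j)`.
  induction S using Finset.induction_on_max_value d generalizing x with
  | empty => simp
  | insert j S hj hmax ih =>
    set V := ⋃ k ∈ S, Icc (a k) (d k) with hV
    set U := ⋃ k ∈ S, Icc (a k) (a k + l * (d k - a k)) with hU
    rw [Finset.set_biUnion_insert, Finset.set_biUnion_insert, ← hV, ← hU]
    have hUsub : U ∩ Iic x ⊆ (Icc (a j) (a j + l * (d j - a j)) ∪ U) ∩ Iic x :=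
      inter_subset_inter_left _ subset_union_right
    -- Here the new interval adds nothing below `x`.
    by_cases htriv : x < a j ∨ d j < a j
    · have hVsub : (Icc (a j) (d j) ∪ V) ∩ Iic x ⊆ V ∩ Iic x := by
        rintro t ⟨ht | ht, htx⟩
        · rw [mem_Iic] at htx
          rcases htriv with h | h <;> linarith [ht.1, ht.2]
        · exact ⟨ht, htx⟩
      calc _ ≤ ENNReal.ofReal l * volume (V ∩ Iic x) := by gcongr
        _ ≤ volume (U ∩ Iic x) := ih x
        _ ≤ _ := measure_mono hUsub
    · push Not at htriv
      obtain ⟨hx, hd⟩ := htriv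
      set y := min x (d j)
      have hay : a j ≤ y := le_min hx hd
      have hVsub : (Icc (a j) (d j) ∪ V) ∩ Iic x ⊆ (V ∩ Iic (a j)) ∪ Icc (a j) y := by
        rintro t ⟨ht, htx⟩
        have htd : t ≤ d j := by
          rcases ht with ht | ht
          · exact ht.2
          · obtain ⟨k, hk, htk⟩ := mem_iUnion₂.1 ht
            exact htk.2.trans (hmax k hk)
        by_cases hta : a j ≤ t
        · exact Or.inr ⟨hta, le_min htx htd⟩
        · refine Or.inl ⟨ht.resolve_left fun h => hta h.1, (not_le.1 hta).le⟩
      have hUsup : (U ∩ Iic (a j)) ∪ Ioc (a j) (a j + l * (y - a j)) ⊆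
          (Icc (a j) (a j + l * (d j - a j)) ∪ U) ∩ Iic x := by
        have hyx : y ≤ x := min_le_left _ _
        have hyd : y ≤ d j := min_le_right _ _
        rintro t (⟨ht, hta⟩ | ⟨hta, ht⟩)
        · exact ⟨Or.inr ht, le_trans hta hx⟩
        · refine ⟨Or.inl ⟨hta.le, ht.trans ?_⟩, ht.trans ?_⟩
          · gcongr
          · nlinarith
      have hdisj : Disjoint (U ∩ Iic (a j)) (Ioc (a j) (a j + l * (y - a j))) :=
        disjoint_left.2 fun t ht ht' => ht'.1.not_ge ht.2
      calc ENNReal.ofReal l * volume ((Icc (a j) (d j) ∪ V) ∩ Iic x)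
          ≤ ENNReal.ofReal l * (volume (V ∩ Iic (a j)) + volume (Icc (a j) y)) := by
            gcongr
            exact (measure_mono hVsub).trans (measure_union_le _ _)
        _ = ENNReal.ofReal l * volume (V ∩ Iic (a j)) +
              volume (Ioc (a j) (a j + l * (y - a j))) := by
            rw [mul_add, Real.volume_Icc, Real.volume_Ioc, ← ENNReal.ofReal_mul hl0,
              add_sub_cancel_left]
        _ ≤ volume (U ∩ Iic (a j)) + volume (Ioc (a j) (a j + l * (y - a j))) := by
            gcongr
            exact ih _
        _ = volume ((U ∩ Iic (a j)) ∪ Ioc (a j) (a j + l * (y - a j))) :=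
            (measure_union hdisj measurableSet_Ioc).symm
        _ ≤ _ := measure_mono hUsup

theorem mul_volume_biUnion_Icc_le (a d : ℕ → ℝ) {l : ℝ} (hl0 : 0 ≤ l) (hl1 : l ≤ 1)
    (S : Finset ℕ) :
    ENNReal.ofReal l * volume (⋃ j ∈ S, Icc (a j) (d j)) ≤
      volume (⋃ j ∈ S, Icc (a j) (a j + l * (d j - a j))) := by
  obtain ⟨x, hx⟩ := (S.finite_toSet.image d).bddAbove
  have h : (⋃ j ∈ S, Icc (a j) (d j)) ⊆ Iic x :=
    iUnion₂_subset fun j hj t ht => ht.2.trans (hx (mem_image_of_mem d hj))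
  calc _ = ENNReal.ofReal l * volume ((⋃ j ∈ S, Icc (a j) (d j)) ∩ Iic x) := by
        rw [inter_eq_left.2 h]
    _ ≤ _ := mul_volume_biUnion_Icc_inter_le a d hl0 hl1 S x
    _ ≤ _ := measure_mono inter_subset_left

/-- The upper envelope of the levels `c j` on the intervals `[a j, d j]`. -/
noncomputable def envelope (S : Finset ℕ) (a d : ℕ → ℝ) (c : ℕ → ℝ≥0) (t : ℝ) : ℝ≥0 :=
  S.sup fun j => (Icc (a j) (d j)).indicator (fun _ => c j) t

theorem measurable_envelope (S : Finset ℕ) (a d : ℕ → ℝ) (c : ℕ → ℝ≥0) :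
    Measurable (envelope S a d c) := by
  unfold envelope
  induction S using Finset.induction_on with
  | empty => simp
  | insert j S hj ih =>
    simp only [Finset.sup_insert]
    exact (measurable_const.indicator measurableSet_Icc).sup ih

theorem le_envelope {S : Finset ℕ} {a d : ℕ → ℝ} (c : ℕ → ℝ≥0) {j : ℕ} (hj : j ∈ S) {t : ℝ}
    (ht : t ∈ Icc (a j) (d j)) : c j ≤ envelope S a d c t := by
  have := Finset.le_sup (f := fun j => (Icc (a j) (d j)).indicator (fun _ => c j) t) hj
  rwa [indicator_of_mem ht] at this

/-- Layer cake: above level `y` the envelope lives on the full intervals with `c j > y`, while `f`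
exceeds `y` on the shortened ones. -/
theorem mul_lintegral_envelope_le {S : Finset ℕ} {a d : ℕ → ℝ} {c : ℕ → ℝ≥0} {l : ℝ}
    (hl0 : 0 ≤ l) (hl1 : l ≤ 1) {f : ℝ → ℝ≥0} (hf : Measurable f) (ha : ∀ j ∈ S, 0 ≤ a j)
    (h : ∀ j ∈ S, ∀ t ∈ Icc (a j) (a j + l * (d j - a j)), c j ≤ f t) :
    ENNReal.ofReal l * ∫⁻ t in Ici (0 : ℝ), (envelope S a d c t : ℝ≥0∞) ≤
      ∫⁻ t in Ici (0 : ℝ), (f t : ℝ≥0∞) := by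
  have hg := measurable_envelope S a d c
  have hlayer {g : ℝ → ℝ≥0} (hg : Measurable g) : ∫⁻ t in Ici (0 : ℝ), (g t : ℝ≥0∞) =
      ∫⁻ y in Ioi (0 : ℝ), volume.restrict (Ici 0) {t | y < (g t : ℝ)} := by
    have := lintegral_eq_lintegral_meas_lt (volume.restrict (Ici (0 : ℝ)))
      (ae_of_all _ fun t => (g t).coe_nonneg) hg.coe_nnreal_real.aemeasurable
    simpa only [ENNReal.ofReal_coe_nnreal] using this
  rw [hlayer hg, hlayer hf, ← lintegral_const_mul' _ _ ENNReal.ofReal_ne_top]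
  refine setLIntegral_mono' measurableSet_Ioi fun y hy => ?_
  lift y to ℝ≥0 using le_of_lt hy
  let T := S.filter fun j => y < c j
  have hbig : {t | (y : ℝ) < envelope S a d c t} ⊆ ⋃ j ∈ T, Icc (a j) (d j) := by
    intro t ht
    obtain ⟨j, hj, hjt⟩ := Finset.lt_sup_iff.1 (NNReal.coe_lt_coe.1 ht)
    have hmem : t ∈ Icc (a j) (d j) := by
      by_contra hne
      rw [indicator_of_notMem hne] at hjt
      exact not_lt_zero hjt
    rw [indicator_of_mem hmem] at hjt
    exact mem_biUnion (x := j) (Finset.mem_coe.2 (Finset.mem_filter.2 ⟨hj, hjt⟩)) hmem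
  have hsmall : (⋃ j ∈ T, Icc (a j) (a j + l * (d j - a j))) ⊆
      {t | (y : ℝ) < f t} ∩ Ici 0 := by
    refine iUnion₂_subset fun j hj t ht => ?_
    obtain ⟨hjS, hjc⟩ := Finset.mem_filter.1 hj
    exact ⟨NNReal.coe_lt_coe.2 (hjc.trans_le (h j hjS t ht)), (ha j hjS).trans ht.1⟩
  calc _ ≤ ENNReal.ofReal l * volume (⋃ j ∈ T, Icc (a j) (d j)) := by
        gcongr
        exact Measure.restrict_le_self
    _ ≤ volume (⋃ j ∈ T, Icc (a j) (a j + l * (d j - a j))) :=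
        mul_volume_biUnion_Icc_le a d hl0 hl1 T
    _ ≤ volume ({t | (y : ℝ) < f t} ∩ Ici 0) := measure_mono hsmall
    _ ≤ _ := Measure.le_restrict_apply _ _

/-- From a virtual dual solution `(α, β)`, the pair `(α / ω, g / ω)` is feasible for `τ`, where `g`
is the envelope over the true windows of what `α` leaves uncovered. The virtual constraints put
every `β i` above these levels on the virtual windows, which are the true windows shortened by `1 -
ω`. -/
theorem mul_opt_le_fractionalOpt_virtual (C : ℕ) (τ : Instance) {ω : ℝ} (hω : 0 < ω)
    (hω1 : ω < 1) :
    ENNReal.ofReal (ω * (1 - ω)) * opt C τ ≤ fractionalOpt C (τ.virtual ω hω) := by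
  refine le_iInf fun α => le_iInf fun β => le_iInf fun h => ?_
  let w : ℝ≥0 := ⟨ω, hω.le⟩
  have hw : w ≠ 0 := fun hw => hω.ne' (congrArg NNReal.toReal hw)
  let a : ℕ → ℝ := fun j => (τ.type j).arrival
  let d : ℕ → ℝ := fun j => (τ.type j).deadline
  let c : ℕ → ℝ≥0 := fun j => ((τ.type j).value * ω / (τ.type j).demand - α j).toNNReal
  let g : ℝ → ℝ≥0 := envelope τ.jobs a d c
  have hgm : Measurable g := measurable_envelope _ _ _ _
  have hfeas : DualFeasible τ (fun j => α j / w) (fun _ : Fin C => fun t => g t / w) := by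
    refine ⟨fun i => hgm.div_const _, fun j hj i t ht => ?_⟩
    have h1 : (c j : ℝ) ≤ g t := NNReal.coe_le_coe.2 (le_envelope c hj ht)
    have h2 : (τ.type j).value * ω / (τ.type j).demand - α j ≤ c j := Real.le_coe_toNNReal _
    have hw' : (w : ℝ) = ω := rfl
    rw [NNReal.coe_div, NNReal.coe_div, hw', ← add_div, le_div_iff₀ hω]
    calc _ = (τ.type j).value * ω / (τ.type j).demand := by ring
      _ ≤ _ := by linarith
  have hg (i : Fin C) : ENNReal.ofReal (1 - ω) * ∫⁻ t in Ici (0 : ℝ), (g t : ℝ≥0∞) ≤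
      ∫⁻ t in Ici (0 : ℝ), (β i t : ℝ≥0∞) := by
    refine mul_lintegral_envelope_le (by linarith) (by linarith) (h.measurable i)
      (fun j _ => (τ.type j).arrival_nonneg) fun j hj t ht => ?_
    have hcov := h.cover j hj i t ⟨ht.1, ht.2.trans (le_of_eq ?_)⟩
    · refine Real.toNNReal_le_iff_le_coe.2 ?_
      have : (τ.type j).value / ((τ.type j).demand / ω) ≤ (α j : ℝ) + β i t := hcov
      rw [div_div_eq_mul_div] at this
      linarith
    · change (τ.type j).arrival + (1 - ω) * ((τ.type j).deadline - (τ.type j).arrival) =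
        (τ.type j).deadline - ω * ((τ.type j).deadline - (τ.type j).arrival)
      ring
  calc ENNReal.ofReal (ω * (1 - ω)) * opt C τ
      ≤ ENNReal.ofReal (ω * (1 - ω)) * dualCost τ (fun j => α j / w)
          (fun _ : Fin C => fun t => g t / w) := by
        gcongr
        exact hfeas.opt_le_dualCost
    _ ≤ dualCost (τ.virtual ω hω) α β := by
        unfold dualCost
        rw [mul_add, Finset.mul_sum, Finset.mul_sum]
        refine add_le_add (Finset.sum_le_sum fun j _ => ?_) (Finset.sum_le_sum fun i _ => ?_)
        -- `D (α / ω) = (D / ω) α`: this part of the cost is unchanged, and `ω (1 - ω) ≤ 1`.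
        · change _ ≤ ENNReal.ofReal ((τ.type j).demand / ω) * _
          have hD := (τ.type j).demand_pos
          have hα : (0 : ℝ) ≤ α j := (α j).2
          rw [← ENNReal.ofReal_coe_nnreal, ← ENNReal.ofReal_coe_nnreal,
            ← ENNReal.ofReal_mul hD.le, ← ENNReal.ofReal_mul (by nlinarith),
            ← ENNReal.ofReal_mul (by positivity)]
          refine ENNReal.ofReal_le_ofReal ?_
          have hw' : (w : ℝ) = ω := rfl
          rw [NNReal.coe_div, hw']
          calc ω * (1 - ω) * ((τ.type j).demand * (α j / ω))
              = (ω * (1 - ω)) * ((τ.type j).demand / ω * α j) := by ring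
            _ ≤ 1 * ((τ.type j).demand / ω * α j) := by
                gcongr
                nlinarith
            _ = _ := one_mul _
        · refine le_trans (le_of_eq ?_) (hg i)
          have hwω : ENNReal.ofReal ω = (w : ℝ≥0∞) := by
            rw [← ENNReal.ofReal_coe_nnreal]
            rfl
          rw [mul_comm ω, ENNReal.ofReal_mul (by linarith), mul_assoc, hwω,
            ← lintegral_const_mul' _ _ ENNReal.coe_ne_top]
          congr 1
          refine lintegral_congr fun t => ?_
          rw [← ENNReal.coe_mul, mul_div_cancel₀ _ hw]

/-! ### Slackness of the virtual instance and the competitive ratio -/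

theorem HasSlackness.virtual {τ : Instance} {s ω : ℝ} (h : HasSlackness τ s) (hω : 0 < ω)
    (hω1 : ω < 1) : HasSlackness (τ.virtual ω hω) (s * (ω * (1 - ω))) := by
  have key (j : ℕ) : (((τ.virtual ω hω).type j).deadline - ((τ.virtual ω hω).type j).arrival) /
      ((τ.virtual ω hω).type j).demand =
      ((τ.type j).deadline - (τ.type j).arrival) / (τ.type j).demand * (ω * (1 - ω)) := by
    change ((τ.type j).deadline - ω * ((τ.type j).deadline - (τ.type j).arrival) -
      (τ.type j).arrival) / ((τ.type j).demand / ω) = _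
    have := (τ.type j).demand_pos.ne'
    field_simp
    ring
  constructor
  · obtain ⟨j, hj, hs⟩ := h.1
    exact ⟨j, hj, by rw [key, hs]⟩
  · rintro x ⟨j, hj, rfl⟩
    rw [key]
    exact mul_le_mul_of_nonneg_right (h.2 ⟨j, hj, rfl⟩) (by nlinarith)

theorem IsReduction.competitiveRatio_le {C : ℕ} {A : Scheduler C} {ω : ℝ} {hω : 0 < ω}
    {R : CommittedScheduler C} (hR : IsReduction A ω hω R) (hA : IsOnline A)
    (hmig : NonMigratory A) (hω1 : ω < 1) (s : ℝ) :
    competitiveRatio R.run s ≤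
      fractionalRatio A (s * (ω * (1 - ω))) / ENNReal.ofReal (ω * (1 - ω)) := by
  have hpos : 0 < ω * (1 - ω) := mul_pos hω (by linarith)
  refine iSup₂_le fun τ hτ => ?_
  rw [ENNReal.le_div_iff_mul_le (Or.inl (ENNReal.ofReal_pos.2 hpos).ne')
    (Or.inl ENNReal.ofReal_ne_top), hR.value_eq hA hmig hω1]
  calc opt C τ / value (τ.virtual ω hω) (A (τ.virtual ω hω)) * ENNReal.ofReal (ω * (1 - ω))
      = ENNReal.ofReal (ω * (1 - ω)) * opt C τ /
          value (τ.virtual ω hω) (A (τ.virtual ω hω)) := by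
        rw [mul_comm, mul_div_assoc]
    _ ≤ fractionalOpt C (τ.virtual ω hω) / value (τ.virtual ω hω) (A (τ.virtual ω hω)) :=
        ENNReal.div_le_div_right (mul_opt_le_fractionalOpt_virtual C τ hω hω1) _
    _ ≤ fractionalRatio A (s * (ω * (1 - ω))) :=
        le_iSup₂_of_le (τ.virtual ω hω) (hτ.virtual hω hω1) le_rfl

end Sched

theorem mainTheorem7 (C : ℕ) (A : Scheduler C) (hA : IsOnline A) (hmig : NonMigratory A)
    (ω s : ℝ) (hω : 0 < ω) (hω1 : ω < 1) (hs : 1 / (ω * (1 - ω)) < s) :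
    (∃ R : CommittedScheduler C, IsReduction A ω hω R) ∧
    ∀ R : CommittedScheduler C, IsReduction A ω hω R →
      IsOnline R.run ∧ NonMigratory R.run ∧ IsResponsive R (ω * s) s ∧
      competitiveRatio R.run s ≤
        fractionalRatio A (s * (ω * (1 - ω))) / ENNReal.ofReal (ω * (1 - ω)) ∧
      (InducesIntegralityGapBound A (s * (ω * (1 - ω))) →
        competitiveRatio R.run s ≤
          competitiveRatio A (s * (ω * (1 - ω))) / ENNReal.ofReal (ω * (1 - ω))) := by
  refine ⟨exists_isReduction hA.causal, fun R hR => ?_⟩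
  have hcr := hR.competitiveRatio_le hA hmig hω1 s
  exact ⟨⟨hR.feasible hA hmig hω1, hR.causal⟩, hR.nonMigratory hmig, hR.isResponsive hA hω1 s,
    hcr, fun hgap => hcr.trans (ENNReal.div_le_div_right hgap _)⟩
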